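/- Let $\mathbb{D}$ be the open unit disk of $\mathbb{C}$. A weight function is a non-decreasing, continuous, unbounded function $w:[0,1)\to(0,+\infty)$; it is extended to a radial weight on $\mathbb{D}$ by $w(z)=w(|z|)$. For functions $u,v$ on a set $X$ with values in $(0,+\infty)$, write $u\asymp v$ (and call $u,v$ equivalent) if there are constants $C_1,C_2>0$ with $C_1u(x)\le v(x)\le C_2u(x)$ for all $x\in X$. For a weight function $v$ put $\Phi_v(x)=\log v(e^x)$, $-\infty<x<0$. The weight function $v$ is called log-convex if $\Phi_v$ is convex on $(-\infty,0)$, and log-tropical if $\Phi_v$ is a tropical power series, that is, if there are a set $E\subset\{0,1,2,\dots\}$ and real numbers $b_j$, $j\in E$, such that $\Phi_v(x)=\sup_{j\in E}(b_j+jx)$ for all $x<0$. **Theorem.** Let $w:[0,1)\to(0,+\infty)$ be an arbitrary weight function. Then the following properties are equivalent: 1. $w$ is approximable by a holomorphic map: there exist $n\in\mathbb{N}$ and a holomorphic map $f:\mathbb{D}\to\mathbb{C}^n$ such that $|f(z)|\asymp w(z)$, $z\in\mathbb{D}$, where $|\cdot|$ is the Euclidean norm; 2. $w$ is essential: $\widetilde{w}(t)\asymp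 w(t)$, $0\le t<1$, where $\widetilde{w}(z)=\sup\{|f(z)| : f \text{ holomorphic on } \mathbb{D},\ |f|\le w \text{ on } \mathbb{D}\}$ for $z\in\mathbb{D}$; 3. there exists a holomorphic function $f$ on $\mathbb{D}$ such that $M_f(t)\asymp w(t)$, $0\le t<1$, where $M_f(t)=\max\{|f(z)| : |z|=t\}$; 4. there exist $a_k\ge 0$, $k=0,1,2,\dots$, such that $\sum_{k=0}^\infty a_kt^k$ converges for all $0\le t<1$ and $\sum_{k=0}^\infty a_kt^k\asymp w(t)$, $0\le t<1$; 5. $w$ is equivalent on $[0,1)$ to a log-tropical weight function; 6. $w$ is equivalent on $[0,1)$ to a log-convex weight function. -/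

import Mathlib

namespace DiskWeight

open Set

/-- The open unit disk of the complex plane. -/
abbrev disk : Set ℂ := Metric.ball (0 : ℂ) 1

/-- `u ≍ v` on `X`: `C₁ u ≤ v ≤ C₂ u` on `X` for some constants `C₁, C₂ > 0`. -/
def EquivOn {α : Type*} (X : Set α) (u v : α → ℝ) : Prop :=
  ∃ C₁ C₂ : ℝ, 0 < C₁ ∧ 0 < C₂ ∧ ∀ x ∈ X, C₁ * u x ≤ v x ∧ v x ≤ C₂ * u x

/-- A weight function `w : [0, 1) → (0, +∞)`: non-decreasing, continuous and unbounded.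
Only the values of `w` on `[0, 1)` matter.
The radial weight on the disk associated with `w` is `z ↦ w ‖z‖`. -/
structure IsWeight (w : ℝ → ℝ) : Prop where
  pos : ∀ t ∈ Ico (0 : ℝ) 1, 0 < w t
  monotoneOn : MonotoneOn w (Ico 0 1)
  continuousOn : ContinuousOn w (Ico 0 1)
  unbounded : ¬ BddAbove (w '' Ico 0 1)

/-- The radial weight `z ↦ w ‖z‖` is equivalent on the disk to `|f|` for some holomorphic map
`f` from the disk to some `ℂⁿ`, where `|·|` is the Euclidean norm. -/
def ApproxByHolomorphicMap (w : ℝ → ℝ) : Prop :=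
  ∃ (n : ℕ) (f : ℂ → EuclideanSpace ℂ (Fin n)),
    DifferentiableOn ℂ f disk ∧ EquivOn disk (fun z => ‖f z‖) (fun z => w ‖z‖)

/-- The associated weight: the supremum of `|f z|` over all holomorphic `f` on the disk with
`|f| ≤ w` there. For `z` in the disk the set is nonempty and bounded above by `w ‖z‖`. -/
noncomputable def associatedWeight (w : ℝ → ℝ) (z : ℂ) : ℝ :=
  sSup {r : ℝ | ∃ f : ℂ → ℂ, DifferentiableOn ℂ f disk ∧ (∀ ζ ∈ disk, ‖f ζ‖ ≤ w ‖ζ‖) ∧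
    r = ‖f z‖}

/-- A weight function is essential if it is equivalent to its associated weight
(which is radial, so that its values on the radius `[0, 1)` determine it). -/
def IsEssential (w : ℝ → ℝ) : Prop :=
  EquivOn (Ico (0 : ℝ) 1) (fun t => associatedWeight w (t : ℂ)) w

/-- `M_f(t) = max {|f z| : |z| = t}`. For `f` continuous on the circle and `t ≥ 0`
the supremum is attained. -/
noncomputable def maxModulus (f : ℂ → ℂ) (t : ℝ) : ℝ :=
  sSup ((fun z => ‖f z‖) '' Metric.sphere (0 : ℂ) t)

/-- `w` is equivalent to `M_f` for some holomorphic function `f` on the disk. -/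
def ApproxByMaxModulus (w : ℝ → ℝ) : Prop :=
  ∃ f : ℂ → ℂ, DifferentiableOn ℂ f disk ∧ EquivOn (Ico (0 : ℝ) 1) (maxModulus f) w

/-- `w` is equivalent on `[0, 1)` to a (convergent) power series with coefficients `a k ≥ 0`. -/
def ApproxByPowerSeries (w : ℝ → ℝ) : Prop :=
  ∃ a : ℕ → ℝ, (∀ k, 0 ≤ a k) ∧ (∀ t ∈ Ico (0 : ℝ) 1, Summable fun k => a k * t ^ k) ∧
    EquivOn (Ico (0 : ℝ) 1) (fun t => ∑' k, a k * t ^ k) w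

/-- The logarithmic transform `Φ_v(x) = log v(e^x)`, considered for `x < 0`. -/
noncomputable def logTransform (v : ℝ → ℝ) (x : ℝ) : ℝ := Real.log (v (Real.exp x))

/-- `Ψ` is a tropical power series on `(-∞, 0)`: for some `E ⊆ {0, 1, 2, …}` and real `b j`,
`Ψ x = sup_{j ∈ E} (b j + j x)` for every `x < 0`, the supremum being finite. -/
def IsTropicalPowerSeries (Ψ : ℝ → ℝ) : Prop :=
  ∃ (E : Set ℕ) (b : ℕ → ℝ), ∀ x < (0 : ℝ), IsLUB ((fun j : ℕ => b j + j * x) '' E) (Ψ x)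

/-- `w` is equivalent to a log-tropical weight function. -/
def EquivLogTropical (w : ℝ → ℝ) : Prop :=
  ∃ v : ℝ → ℝ, IsWeight v ∧ IsTropicalPowerSeries (logTransform v) ∧
    EquivOn (Ico (0 : ℝ) 1) v w

/-- `v` is log-convex: `log v(t)` is a convex function of `log t`, `0 < t < 1`. -/
def IsLogConvex (v : ℝ → ℝ) : Prop := ConvexOn ℝ (Iio 0) (logTransform v)

/-- `w` is equivalent to a log-convex weight function. -/
def EquivLogConvex (w : ℝ → ℝ) : Prop :=
  ∃ v : ℝ → ℝ, IsWeight v ∧ IsLogConvex v ∧ EquivOn (Ico (0 : ℝ) 1) v w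

end DiskWeight

open Set Filter Topology

/-! Everything passes through log-convexity, in the variable x = log t, where a monomial becomes a
line with integer slope.

From log-convexity to series: a convex nondecreasing Φ, bounded below, stays within a constant of
the supremum of the lines of integer slope lying below it (`exists_le_line_intercept_add`), which is
the tropical statement. That supremum may have many nearly maximal lines. A greedy choice
(`exists_next_slope`, `exists_lacunary_slopes`) keeps a subsequence that still recovers it up to a
constant, while at each x the other lines drop linearly in the index distance from the top one.
Exponentiated, all but boundedly many terms are negligible, so the sum of the series is comparable
to the weight. At a general complex z the two largest terms may cancel; splitting the series by the
parity of the index leaves a single dominant term in one of the two halves, so the two sums form a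
map into ℂ² of the right size.

Back to log-convexity: each approximation supplies scalar functions below the weight that are nearly
extremal, so the weight is essential; the associated weight is log-convex by the three circles
theorem, applied to each competitor. -/

namespace DiskWeight

/-! ### Envelopes of lines with integer slopes -/

section Lines

/-- The line of slope `m` and intercept `b m`. -/
def line (b : ℕ → ℝ) (m : ℕ) (x : ℝ) : ℝ := b m + m * x

/-- The abscissa at which the lines of slopes `m` and `m + 1` meet. -/
def node (b : ℕ → ℝ) (m : ℕ) : ℝ := b m - b (m + 1)

variable {b : ℕ → ℝ}

theorem line_sub_line_mono {i m : ℕ} (him : i ≤ m) {x y : ℝ} (hxy : x ≤ y) :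
    line b m x - line b i x ≤ line b m y - line b i y := by
  have h : (i : ℝ) ≤ m := by exact_mod_cast him
  unfold line
  nlinarith [mul_nonneg (sub_nonneg.2 h) (sub_nonneg.2 hxy)]

/-- Monotone nodes mean that the intercepts are concave, so to the left of a node every further
increase of slope only loses. -/
theorem line_le_of_le_node (hd : Monotone (node b)) {m i : ℕ} (hmi : m ≤ i)
    {x : ℝ} (hx : x ≤ node b m) : line b i x ≤ line b m x := by
  induction i, hmi using Nat.le_induction with
  | base => rfl
  | succ i hi ih =>
    have := hd hi
    unfold line node at *
    push_cast
    linarith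

theorem line_le_of_node_le {i m : ℕ} (him : i ≤ m) {x : ℝ} (hx : ∀ j < m, node b j ≤ x) :
    line b i x ≤ line b m x := by
  induction m, him using Nat.le_induction with
  | base => rfl
  | succ m hm ih =>
    have h2 := ih fun j hj => hx j (by omega)
    have h1 := hx m (by omega)
    unfold line node at *
    push_cast
    linarith

theorem line_le_at_node (hd : Monotone (node b)) (i m : ℕ) :
    line b i (node b m) ≤ line b m (node b m) := by
  rcases le_total i m with h | h
  · exact line_le_of_node_le h fun j hj => hd hj.le
  · exact line_le_of_le_node hd h le_rfl

theorem node_neg (hd : Monotone (node b)) (hb : Monotone b) (hub : ∀ M, ∃ m, M < b m) (m : ℕ) :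
    node b m < 0 := by
  by_contra! h
  obtain ⟨M, hM⟩ := hub (b m)
  rcases le_total m M with hm | hm
  · have := line_le_of_le_node hd hm h
    simp only [line, mul_zero, add_zero] at this
    linarith
  · exact absurd (hb hm) (not_le.2 hM)

/-- If all nodes were at most x < 0, the lines would stay above `b 0` at x, hence grow without bound
at x / 2 as the slope increases. -/
theorem eventually_lt_node (hd : Monotone (node b))
    (hbd : ∀ x < (0 : ℝ), ∃ B, ∀ m, line b m x ≤ B) {x : ℝ} (hx : x < 0) :
    ∀ᶠ m in atTop, x < node b m := by
  have : ∃ m, x < node b m := by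
    by_contra! h
    obtain ⟨B, hB⟩ := hbd (x / 2) (by linarith)
    obtain ⟨m, hm⟩ := exists_nat_gt ((B - b 0) / (-x / 2))
    have h1 := line_le_of_node_le (b := b) (Nat.zero_le m) (x := x) fun j _ => h j
    have h2 := hB m
    rw [div_lt_iff₀ (by linarith)] at hm
    simp only [line, Nat.cast_zero, zero_mul, add_zero] at h1 h2
    linarith
  obtain ⟨m, hm⟩ := this
  filter_upwards [eventually_ge_atTop m] with i hi using hm.trans_le (hd hi)

/-- The nodes tend to 0, and a line of large intercept already beats `b m + A` near 0; at its own
node the line of slope `m'` is maximal, hence beats it too. -/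
theorem eventually_line_add_le_at_own_node (hd : Monotone (node b)) (hb : Monotone b)
    (hub : ∀ M, ∃ m, M < b m) (hbd : ∀ x < (0 : ℝ), ∃ B, ∀ m, line b m x ≤ B) (m : ℕ) (A : ℝ) :
    ∀ᶠ m' in atTop, line b m (node b m') + A ≤ line b m' (node b m') := by
  obtain ⟨i, hi⟩ := hub (b m + A + 1)
  have hpos : (0 : ℝ) < (i : ℝ) + 1 := by positivity
  filter_upwards [eventually_lt_node hd hbd (x := -1 / ((i : ℝ) + 1))
    (div_neg_of_neg_of_pos (by norm_num) hpos)] with m' hm'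
  have h1 := line_le_at_node hd i m'
  have h0 := node_neg hd hb hub m'
  rw [div_lt_iff₀ hpos] at hm'
  have h2 : (m : ℝ) * node b m' ≤ 0 := mul_nonpos_of_nonneg_of_nonpos (by positivity) h0.le
  have h3 : line b m (node b m') = b m + m * node b m' := rfl
  have h4 : line b i (node b m') = b i + i * node b m' := rfl
  linarith

theorem eventually_line_add_le_at_node (hbd : ∀ x < (0 : ℝ), ∃ B, ∀ m, line b m x ≤ B)
    {x : ℝ} (hx : x < 0) (c : ℝ) : ∀ᶠ m in atTop, line b m x ≤ c := by
  obtain ⟨B, hB⟩ := hbd (x / 2) (by linarith)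
  have h1 : Tendsto (fun m : ℕ => (m : ℝ) * (x / 2)) atTop atBot :=
    tendsto_natCast_atTop_atTop.atTop_mul_const_of_neg (by linarith)
  filter_upwards [h1.eventually_le_atBot (c - B)] with m hm
  have := hB m
  unfold line at *
  linarith

/-- Given a slope `m`, a larger slope can be chosen such that each of the two lines dominates the
other one by `A` at its own node, while between the nodes the two lines suffice to recover all the
lines up to a constant. -/
theorem exists_next_slope (hd : Monotone (node b)) (hb : Monotone b)
    (hub : ∀ M, ∃ m, M < b m) (hbd : ∀ x < (0 : ℝ), ∃ B, ∀ m, line b m x ≤ B)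
    {A : ℝ} (hA : 0 ≤ A) (m : ℕ) :
    ∃ m' > m, line b m (node b m') + A ≤ line b m' (node b m') ∧
      line b m' (node b m) + A ≤ line b m (node b m) ∧
      ∀ x, node b m ≤ x → x ≤ node b m' → ∀ i,
        line b i x ≤ max (line b m x) (line b m' x) + (A - node b 0) := by
  classical
  have hex : ∃ m', m < m' ∧ line b m (node b m') + A ≤ line b m' (node b m') ∧
      line b m' (node b m) + A ≤ line b m (node b m) := by
    obtain ⟨m', h1, h2, h3⟩ := ((eventually_gt_atTop m).and
      ((eventually_line_add_le_at_own_node hd hb hub hbd m A).and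
        (eventually_line_add_le_at_node hbd (node_neg hd hb hub m)
          (line b m (node b m) - A)))).exists
    exact ⟨m', h1, h2, by linarith⟩
  -- The least admissible slope is taken: the failure of its predecessor `p` is what prevents a gap
  -- in the envelope.
  obtain ⟨h1, h2, h3⟩ := Nat.find_spec hex
  have hmin := fun j => Nat.find_min hex (m := j)
  set m' := Nat.find hex
  refine ⟨m', h1, h2, h3, fun x hx hx' i => ?_⟩
  have h00 := node_neg hd hb hub 0
  have hx0 := hx'.trans_lt (node_neg hd hb hub m')
  have hxd : node b 0 ≤ x := (hd (Nat.zero_le m)).trans hx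
  obtain ⟨p, hp⟩ : ∃ p, m' = p + 1 := ⟨m' - 1, by omega⟩
  have hml := le_max_left (line b m x) (line b m' x)
  have hmr := le_max_right (line b m x) (line b m' x)
  rcases le_total (node b p) x with hpx | hpx
  · have : line b i x ≤ line b m' x := by
      rcases le_total i m' with h | h
      · exact line_le_of_node_le h fun j hj => (hd (by omega : j ≤ p)).trans hpx
      · exact line_le_of_le_node hd h hx'
    linarith
  rcases lt_or_ge i m with him | him
  · have := line_le_of_node_le (b := b) (x := x) him.le fun j hj => (hd hj.le).trans hx
    linarith
  rcases (show m ≤ p by omega).eq_or_lt with hmp | hmp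
  · have := line_le_of_le_node hd him (hmp ▸ hpx)
    linarith
  have hnot := hmin p (by omega)
  simp only [hmp, true_and, not_and_or, not_le] at hnot
  -- If `p` fails at its own node, slope `m` alone recovers the envelope up to `A`. If it fails at
  -- the node of `m`, slope `p` does, and replacing `p` by `p + 1` costs at most `-x ≤ -node b 0`.
  rcases hnot with h | h
  · have e1 := line_sub_line_mono (b := b) him hpx
    have e2 := line_le_at_node hd i p
    linarith
  · have e1 : line b i x ≤ line b p x + A := by
      rcases le_total i p with hip | hip
      · have := line_sub_line_mono (b := b) hip hx
        have := line_le_at_node hd i m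
        linarith
      · have := line_le_of_le_node hd hip hpx
        linarith
    have e2 : line b p x ≤ line b m' x - x := by
      have := node_neg hd hb hub p
      rw [hp]
      unfold line node at *
      push_cast
      linarith
    linarith

/-- A lacunary choice of slopes: the selected lines decay geometrically away from the maximal one,
which recovers the supremum of all the lines up to a constant. -/
theorem exists_lacunary_slopes (hd : Monotone (node b)) (hb : Monotone b)
    (hub : ∀ M, ∃ m, M < b m) (hbd : ∀ x < (0 : ℝ), ∃ B, ∀ m, line b m x ≤ B)
    {A : ℝ} (hA : 0 ≤ A) :
    ∃ n : ℕ → ℕ, StrictMono n ∧ n 0 = 0 ∧ ∃ C : ℝ, ∀ x < (0 : ℝ), ∃ K,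
      (∀ i, line b i x ≤ line b (n K) x + C) ∧
      ∀ j, line b (n j) x ≤ line b (n K) x + A - A * ((j - K : ℕ) + (K - j : ℕ)) := by
  classical
  choose next hgt hown hprev hbetween using exists_next_slope hd hb hub hbd hA
  set n : ℕ → ℕ := fun k => next^[k] 0
  have hn : ∀ k, n (k + 1) = next (n k) := fun k => Function.iterate_succ_apply' next k 0
  have hmono : StrictMono n := strictMono_nat_of_lt_succ fun k => hn k ▸ hgt (n k)
  have hA0 : 0 ≤ A - node b 0 := by linarith [node_neg hd hb hub 0]
  -- The gap `A` at a node persists to its left for larger slopes and, in `hup`, to its right for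
  -- smaller ones; the gaps add up along the chain.
  have hdown : ∀ x k, x ≤ node b (n k) → ∀ p, line b (n (k + p)) x + A * p ≤ line b (n k) x := by
    intro x k hx p
    induction p with
    | zero => simp
    | succ p ih =>
      have e1 : x ≤ node b (n (k + p)) := hx.trans (hd (hmono.monotone (by omega)))
      have e2 := line_sub_line_mono (b := b) (hgt (n (k + p))).le e1
      have e3 := hprev (n (k + p))
      rw [← hn] at e2 e3
      rw [← add_assoc]
      push_cast
      linarith
  have hup : ∀ x p k, node b (n (k + p)) ≤ x → line b (n k) x + A * p ≤ line b (n (k + p)) x := by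
    intro x p
    induction p with
    | zero => simp
    | succ p ih =>
      intro k hx
      rw [← add_assoc] at hx ⊢
      have e2 := line_sub_line_mono (b := b) (hgt (n (k + p))).le (hn (k + p) ▸ hx)
      have e3 := hown (n (k + p))
      have e4 := ih k ((hd (hmono.monotone (by omega))).trans hx)
      rw [← hn] at e2 e3
      push_cast
      linarith
  refine ⟨n, hmono, rfl, A - node b 0, fun x hx => ?_⟩
  by_cases hx0 : x ≤ node b (n 0)
  · refine ⟨0, fun i => ?_, fun j => ?_⟩
    · have := line_le_of_le_node hd (Nat.zero_le i) hx0
      have : line b (n 0) x = line b 0 x := rfl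
      linarith
    · have := hdown x 0 hx0 j
      rw [zero_add] at this
      simp only [Nat.sub_zero, Nat.zero_sub, Nat.cast_zero, add_zero]
      linarith
  have hex : ∃ k, x ≤ node b (n k) := by
    obtain ⟨k, hk⟩ := (hmono.tendsto_atTop.eventually (eventually_lt_node hd hbd hx)).exists
    exact ⟨k, hk.le⟩
  have hs := Nat.find_spec hex
  have hmin := fun j => Nat.find_min hex (m := j)
  obtain ⟨k, hk⟩ : ∃ k, Nat.find hex = k + 1 :=
    ⟨Nat.find hex - 1, by
      have : Nat.find hex ≠ 0 := fun h => hx0 (by rwa [h] at hs)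
      omega⟩
  rw [hk] at hs
  have hlow : node b (n k) ≤ x := (not_le.1 (hmin k (by omega))).le
  have hall : ∀ i, line b i x ≤ max (line b (n k) x) (line b (n (k + 1)) x) + (A - node b 0) := by
    rw [hn] at hs ⊢
    exact hbetween (n k) x hlow hs
  have hlo : ∀ j ≤ k, line b (n j) x + A * (k - j : ℕ) ≤ line b (n k) x := fun j hj => by
    have := hup x (k - j) j (by rwa [Nat.add_sub_cancel' hj])
    rwa [Nat.add_sub_cancel' hj] at this
  have hhi : ∀ j ≥ k + 1, line b (n j) x + A * (j - (k + 1) : ℕ) ≤ line b (n (k + 1)) x :=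
    fun j hj => by
      have := hdown x (k + 1) hs (j - (k + 1))
      rwa [Nat.add_sub_cancel' hj] at this
  -- `K` is the better of the two neighbours of x. The other one may tie with it, hence the spare
  -- `A` in the bound. One of the truncated differences always vanishes, so their sum is |j - K|.
  rcases le_total (line b (n k) x) (line b (n (k + 1)) x) with h | h
  · refine ⟨k + 1, fun i => by simpa [h] using hall i, fun j => ?_⟩
    rcases Nat.lt_or_ge k j with hj | hj
    · have := hhi j hj
      rw [Nat.sub_eq_zero_of_le (show k + 1 ≤ j from hj)]
      push_cast
      linarith
    · have := hlo j hj
      rw [Nat.sub_eq_zero_of_le (show j ≤ k + 1 by omega), Nat.succ_sub hj]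
      push_cast
      linarith
  · refine ⟨k, fun i => by simpa [h] using hall i, fun j => ?_⟩
    rcases Nat.lt_or_ge k j with hj | hj
    · have := hhi j hj
      rw [Nat.sub_eq_zero_of_le hj.le, show j - k = (j - (k + 1)) + 1 by omega]
      push_cast
      linarith
    · have := hlo j hj
      rw [Nat.sub_eq_zero_of_le hj]
      push_cast
      linarith

end Lines

/-! ### Integer-slope minorants of a convex function -/

section Convex

/-- The largest intercept of a line of slope `m` lying below `Φ` on the negative half-line. -/
noncomputable def intercept (Φ : ℝ → ℝ) (m : ℕ) : ℝ := sInf ((fun x => Φ x - m * x) '' Iio 0)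

variable {Φ : ℝ → ℝ} {L : ℝ}

theorem line_intercept_le (hL : ∀ x < 0, L ≤ Φ x) (m : ℕ) {x : ℝ} (hx : x < 0) :
    line (intercept Φ) m x ≤ Φ x := by
  have : intercept Φ m ≤ Φ x - m * x := by
    refine csInf_le ⟨L, ?_⟩ ⟨x, hx, rfl⟩
    rintro _ ⟨y, hy, rfl⟩
    have : (m : ℝ) * y ≤ 0 := mul_nonpos_of_nonneg_of_nonpos (by positivity) (le_of_lt hy)
    have := hL y hy
    simp only
    linarith
  unfold line
  linarith

theorem le_intercept {m : ℕ} {c : ℝ} (h : ∀ x < 0, c ≤ Φ x - m * x) : c ≤ intercept Φ m := by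
  refine le_csInf ⟨_, ⟨-1, by simp, rfl⟩⟩ ?_
  rintro _ ⟨x, hx, rfl⟩
  exact h x hx

theorem monotone_intercept (hL : ∀ x < 0, L ≤ Φ x) : Monotone (intercept Φ) := by
  refine fun i m him => le_intercept fun x hx => ?_
  have h := line_intercept_le hL i hx
  have : (m : ℝ) * x ≤ i * x := mul_le_mul_of_nonpos_right (by exact_mod_cast him) hx.le
  unfold line at h
  linarith

/-- As an infimum of functions affine in `m`, the intercept is concave in `m`. -/
theorem monotone_node_intercept (hL : ∀ x < 0, L ≤ Φ x) : Monotone (node (intercept Φ)) := by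
  refine monotone_nat_of_le_succ fun m => ?_
  have : (intercept Φ m + intercept Φ (m + 1 + 1)) / 2 ≤ intercept Φ (m + 1) := by
    refine le_intercept fun x hx => ?_
    have h1 := line_intercept_le hL m hx
    have h2 := line_intercept_le hL (m + 1 + 1) hx
    unfold line at h1 h2
    push_cast at *
    linarith
  unfold node
  linarith

/-- Here `m + 1` is the least integer slope whose line through the point of abscissa `x₀` exceeds Φ
somewhere to the right; convexity then puts that line below Φ on the left. Slope 0 never exceeds, by
monotonicity. -/
theorem exists_integer_slope (hconv : ConvexOn ℝ (Iio 0) Φ) (hmono : MonotoneOn Φ (Iio 0))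
    {x₀ : ℝ} (hx₀ : x₀ < 0) :
    ∃ m : ℕ, (∀ x, x₀ < x → x < 0 → Φ x₀ + m * (x - x₀) ≤ Φ x) ∧
      ∀ x < x₀, Φ x₀ + (m + 1) * (x - x₀) ≤ Φ x := by
  classical
  have hex : ∃ m : ℕ, ∃ x, x₀ < x ∧ x < 0 ∧ Φ x < Φ x₀ + m * (x - x₀) := by
    obtain ⟨m, hm⟩ := exists_nat_gt ((Φ (x₀ / 2) - Φ x₀) / (x₀ / 2 - x₀))
    rw [div_lt_iff₀ (by linarith)] at hm
    exact ⟨m, x₀ / 2, by linarith, by linarith, by linarith⟩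
  obtain ⟨y, hy, hy0, hΦ⟩ := Nat.find_spec hex
  have hmin := fun j => Nat.find_min hex (m := j)
  obtain ⟨m, hm⟩ : ∃ m, Nat.find hex = m + 1 := by
    refine ⟨Nat.find hex - 1, ?_⟩
    have : Nat.find hex ≠ 0 := fun h => by
      rw [h] at hΦ
      have := hmono hx₀ hy0 hy.le
      simp only [Nat.cast_zero, zero_mul, add_zero] at hΦ
      linarith
    omega
  refine ⟨m, fun x hx hx0 => ?_, fun x hx => ?_⟩
  · have := hmin m (by omega)
    push Not at this
    exact this x hx hx0
  · rw [hm] at hΦ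
    have h := hconv.slope_mono_adjacent (show x ∈ Iio (0 : ℝ) from hx.trans hx₀) hy0 hx hy
    have h2 : (Φ y - Φ x₀) / (y - x₀) ≤ (m + 1 : ℕ) := by
      rw [div_le_iff₀ (by linarith)]
      linarith
    have h3 := h.trans h2
    rw [div_le_iff₀ (by linarith)] at h3
    push_cast at h3
    linarith

/-- Rounding the slope costs at most 1 on [-1, 0). To the left of -1 a subgradient estimate is not
needed: Φ lies between `L` and `Φ (-1)` there. -/
theorem exists_le_line_intercept_add (hconv : ConvexOn ℝ (Iio 0) Φ)
    (hmono : MonotoneOn Φ (Iio 0)) (hL : ∀ x < 0, L ≤ Φ x) {x₀ : ℝ} (hx₀ : x₀ < 0) :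
    ∃ m : ℕ, Φ x₀ ≤ line (intercept Φ) m x₀ + (1 + Φ (-1) - L) := by
  rcases lt_or_ge x₀ (-1) with h | h
  · refine ⟨0, ?_⟩
    have h1 : L ≤ intercept Φ 0 := le_intercept fun x hx => by simpa using hL x hx
    have h2 := hmono hx₀ (show (-1 : ℝ) ∈ Iio 0 by simp) h.le
    simp only [line, Nat.cast_zero, zero_mul, add_zero]
    linarith
  · obtain ⟨m, hr, hl⟩ := exists_integer_slope hconv hmono hx₀
    refine ⟨m, ?_⟩
    have hL1 := hL (-1) (by norm_num)
    have : Φ x₀ - m * x₀ - (1 + Φ (-1) - L) ≤ intercept Φ m := by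
      refine le_intercept fun x hx => ?_
      rcases lt_or_ge x (-1) with hx1 | hx1
      · have h1 : Φ x₀ + (m + 1) * (-1 - x₀) ≤ Φ (-1) := by
          rcases h.eq_or_lt with e | e
          · rw [← e]; simp
          · exact hl _ e
        have h2 : (m : ℝ) * x ≤ m * (-1) := mul_le_mul_of_nonneg_left hx1.le (by positivity)
        have := hL x hx
        linarith
      · rcases lt_trichotomy x x₀ with e | e | e
        · have := hl x e
          linarith
        · rw [e]; linarith
        · have := hr x e hx
          linarith
    unfold line
    linarith

theorem exists_lt_intercept (hconv : ConvexOn ℝ (Iio 0) Φ) (hmono : MonotoneOn Φ (Iio 0))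
    (hL : ∀ x < 0, L ≤ Φ x) (hunb : ∀ M, ∃ x < 0, M < Φ x) (M : ℝ) : ∃ m, M < intercept Φ m := by
  obtain ⟨x, hx, hM⟩ := hunb (M + (1 + Φ (-1) - L))
  obtain ⟨m, hm⟩ := exists_le_line_intercept_add hconv hmono hL hx
  have : (m : ℝ) * x ≤ 0 := mul_nonpos_of_nonneg_of_nonpos (by positivity) hx.le
  unfold line at hm
  exact ⟨m, by linarith⟩

end Convex

/-! ### From log-convex weights to lacunary terms -/

section Weight

variable {v : ℝ → ℝ}

theorem exp_mem_Ico {x : ℝ} (hx : x < 0) : Real.exp x ∈ Ico (0 : ℝ) 1 :=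
  ⟨(Real.exp_pos x).le, Real.exp_lt_one_iff.2 hx⟩

theorem zero_mem_Ico : (0 : ℝ) ∈ Ico (0 : ℝ) 1 := ⟨le_rfl, one_pos⟩

theorem IsWeight.exp_logTransform (hv : IsWeight v) {x : ℝ} (hx : x < 0) :
    Real.exp (logTransform v x) = v (Real.exp x) := Real.exp_log (hv.pos _ (exp_mem_Ico hx))

theorem IsWeight.log_le_logTransform (hv : IsWeight v) : ∀ x < 0, Real.log (v 0) ≤ logTransform v x :=
  fun _ hx => Real.log_le_log (hv.pos _ zero_mem_Ico)
    (hv.monotoneOn zero_mem_Ico (exp_mem_Ico hx) (Real.exp_pos _).le)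

theorem IsWeight.monotoneOn_logTransform (hv : IsWeight v) : MonotoneOn (logTransform v) (Iio 0) :=
  fun _ hx _ hy hxy => Real.log_le_log (hv.pos _ (exp_mem_Ico hx))
    (hv.monotoneOn (exp_mem_Ico hx) (exp_mem_Ico hy) (Real.exp_le_exp.2 hxy))

theorem IsWeight.exists_lt_logTransform (hv : IsWeight v) (M : ℝ) : ∃ x < 0, M < logTransform v x := by
  by_contra! h
  refine hv.unbounded ⟨Real.exp M, ?_⟩
  have key : ∀ x < 0, v (Real.exp x) ≤ Real.exp M := fun x hx => by
    rw [← hv.exp_logTransform hx]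
    exact Real.exp_le_exp.2 (h x hx)
  rintro _ ⟨t, ht, rfl⟩
  rcases ht.1.eq_or_lt with h0 | h0
  · rw [← h0]
    exact (hv.monotoneOn zero_mem_Ico (exp_mem_Ico (x := -1) (by norm_num))
      (Real.exp_pos _).le).trans (key _ (by norm_num))
  · simpa [Real.exp_log h0] using key (Real.log t) (Real.log_neg h0 ht.2)

theorem exp_line_eq {b : ℕ → ℝ} {m : ℕ} {t : ℝ} (ht : 0 < t) :
    Real.exp (line b m (Real.log t)) = Real.exp (b m) * t ^ m := by
  rw [line, Real.exp_add, Real.exp_nat_mul, Real.exp_log ht]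

theorem IsWeight.exp_intercept_zero_le (hv : IsWeight v) :
    Real.exp (intercept (logTransform v) 0) ≤ v 0 := by
  have hc := (hv.continuousOn 0 zero_mem_Ico).mono_left
    (nhdsWithin_mono (0 : ℝ) (Ioo_subset_Ico_self : Ioo (0 : ℝ) 1 ⊆ _))
  have : (𝓝[Ioo (0 : ℝ) 1] 0).NeBot := left_nhdsWithin_Ioo_neBot one_pos
  refine ge_of_tendsto hc (eventually_mem_nhdsWithin.mono fun t ht => ?_)
  have hx : Real.log t < 0 := Real.log_neg ht.1 ht.2
  have := Real.exp_le_exp.2 (line_intercept_le hv.log_le_logTransform 0 hx)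
  rw [hv.exp_logTransform hx, exp_line_eq ht.1, Real.exp_log ht.1] at this
  simpa using this

/-- A log-convex weight is equivalent to the maximal term of a lacunary power series whose terms
decay geometrically away from the maximal one. -/
theorem exists_lacunary_terms (hv : IsWeight v) (hc : IsLogConvex v) :
    ∃ n : ℕ → ℕ, StrictMono n ∧ ∃ a : ℕ → ℝ, (∀ j, 0 < a j) ∧ ∃ C : ℝ, 0 < C ∧
      ∀ t ∈ Ico (0 : ℝ) 1, ∃ K, a K * t ^ n K ≤ v t ∧ v t ≤ C * (a K * t ^ n K) ∧
        ∀ j, a j * t ^ n j ≤ 16 * (1 / 16) ^ ((j - K) + (K - j)) * (a K * t ^ n K) := by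
  set Φ := logTransform v with hΦ
  set b := intercept Φ with hb
  have hL := hv.log_le_logTransform
  have hM := hv.monotoneOn_logTransform
  -- The gap log 16 gives ratio 1/16, small enough to absorb the factor 16 once indices are
  -- separated by parity.
  obtain ⟨n, hn, hn0, C, hC⟩ := exists_lacunary_slopes (b := b) (monotone_node_intercept hL)
    (monotone_intercept hL) (exists_lt_intercept hc hM hL hv.exists_lt_logTransform)
    (fun x hx => ⟨Φ x, fun m => line_intercept_le hL m hx⟩) (A := Real.log 16)
    (Real.log_nonneg (by norm_num))
  set D := 1 + Φ (-1) - Real.log (v 0)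
  refine ⟨n, hn, fun j => Real.exp (b (n j)), fun j => Real.exp_pos _, max 1 (Real.exp (C + D)),
    lt_max_of_lt_left one_pos, fun t ht => ?_⟩
  rcases ht.1.eq_or_lt with h0 | h0
  · subst h0
    -- At t = 0 only the constant term survives, and it is present because `n 0 = 0`.
    refine ⟨0, ?_, ?_, fun j => ?_⟩
    · simpa [hn0] using hv.exp_intercept_zero_le
    · have h1 : Real.log (v 0) ≤ b 0 := le_intercept fun x hx => by simpa using hL x hx
      have h2 := Real.exp_le_exp.2 h1
      rw [Real.exp_log (hv.pos _ zero_mem_Ico)] at h2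
      simp only [hn0, pow_zero, mul_one]
      nlinarith [le_max_left 1 (Real.exp (C + D)), Real.exp_pos (b 0)]
    · rcases Nat.eq_zero_or_pos j with rfl | hj
      · simp only [hn0]
        norm_num
        linarith [Real.exp_pos (b 0)]
      · have : n j ≠ 0 := (hn0 ▸ hn hj).ne'
        rw [zero_pow this, mul_zero]
        positivity
  · have hx : Real.log t < 0 := Real.log_neg h0 ht.2
    have hvt : v t = Real.exp (Φ (Real.log t)) := by
      rw [hΦ, hv.exp_logTransform hx, Real.exp_log h0]
    obtain ⟨K, hK, hdec⟩ := hC (Real.log t) hx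
    refine ⟨K, ?_, ?_, fun j => ?_⟩
    · rw [hvt, ← exp_line_eq h0]
      exact Real.exp_le_exp.2 (line_intercept_le hL _ hx)
    · obtain ⟨m, hm⟩ := exists_le_line_intercept_add hc hM hL hx
      rw [hvt, ← exp_line_eq h0]
      refine le_trans ?_ (mul_le_mul_of_nonneg_right (le_max_right _ _) (Real.exp_pos _).le)
      rw [← Real.exp_add]
      refine Real.exp_le_exp.2 ?_
      have := hK m
      linarith
    · simp only [← exp_line_eq h0]
      have := Real.exp_le_exp.2 (hdec j)
      refine this.trans_eq ?_
      have e : -(Real.log 16 * (((j - K : ℕ) : ℝ) + (K - j : ℕ))) =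
          ((j - K + (K - j) : ℕ) : ℝ) * -Real.log 16 := by
        push_cast
        ring
      rw [sub_eq_add_neg, e, Real.exp_add, Real.exp_add, Real.exp_nat_mul, Real.exp_neg,
        Real.exp_log (by norm_num), ← one_div]
      ring

end Weight

/-! ### Calculus of equivalence -/

section EquivOn

variable {α : Type*} {X : Set α} {u v w : α → ℝ}

theorem EquivOn.trans (h₁ : EquivOn X u v) (h₂ : EquivOn X v w) : EquivOn X u w := by
  obtain ⟨a, b, ha, hb, h⟩ := h₁
  obtain ⟨c, d, hc, hd, h'⟩ := h₂
  refine ⟨c * a, d * b, by positivity, by positivity, fun x hx => ⟨?_, ?_⟩⟩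
  · rw [mul_assoc]
    exact (mul_le_mul_of_nonneg_left (h x hx).1 hc.le).trans (h' x hx).1
  · rw [mul_assoc]
    exact (h' x hx).2.trans (mul_le_mul_of_nonneg_left (h x hx).2 hd.le)

theorem EquivOn.comp {β : Type*} {Y : Set β} {g : β → α} (h : EquivOn X u v) (hg : MapsTo g Y X) :
    EquivOn Y (fun y => u (g y)) (fun y => v (g y)) := by
  obtain ⟨a, b, ha, hb, h⟩ := h
  exact ⟨a, b, ha, hb, fun y hy => h _ (hg hy)⟩

theorem EquivOn.of_eq (h : EquivOn X u v) {u' : α → ℝ} (he : ∀ x ∈ X, u' x = u x) :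
    EquivOn X u' v := by
  obtain ⟨a, b, ha, hb, h⟩ := h
  exact ⟨a, b, ha, hb, fun x hx => by rw [he x hx]; exact h x hx⟩

end EquivOn

/-! ### Continuity and unboundedness of comparable functions -/

section LogConvex

theorem norm_mem_Ico {z : ℂ} (hz : z ∈ disk) : ‖z‖ ∈ Ico (0 : ℝ) 1 :=
  ⟨norm_nonneg z, mem_ball_zero_iff.1 hz⟩

theorem norm_lt_one_of_mem_Ico {t : ℝ} (ht : t ∈ Ico (0 : ℝ) 1) : (t : ℂ) ∈ disk := by
  simpa [abs_of_nonneg ht.1] using ht.2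

/-- A log-convex monotone function is continuous, provided that it is dominated by a continuous
function with the same value at the origin. -/
theorem IsLogConvex.continuousOn {u v : ℝ → ℝ} (hu : IsLogConvex u)
    (hpos : ∀ t ∈ Ico (0 : ℝ) 1, 0 < u t) (hmono : MonotoneOn u (Ico 0 1))
    (hv : ContinuousOn v (Ico 0 1)) (huv : ∀ t ∈ Ico (0 : ℝ) 1, u t ≤ v t) (h0 : u 0 = v 0) :
    ContinuousOn u (Ico 0 1) := by
  intro t ht
  rcases ht.1.eq_or_lt with h | h
  · subst h
    refine tendsto_of_tendsto_of_tendsto_of_le_of_le' (tendsto_const_nhds (x := u 0))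
      (h0 ▸ hv 0 zero_mem_Ico)
      (eventually_mem_nhdsWithin.mono fun t ht => hmono zero_mem_Ico ht ht.1)
      (eventually_mem_nhdsWithin.mono fun t ht => huv t ht)
  · have hc : ContinuousAt (logTransform u) (Real.log t) :=
      (ConvexOn.continuousOn isOpen_Iio hu).continuousAt (Iio_mem_nhds (Real.log_neg h ht.2))
    have hc2 : ContinuousAt (fun s => Real.exp (logTransform u (Real.log s))) t :=
      Real.continuous_exp.continuousAt.comp
        (ContinuousAt.comp (f := Real.log) hc (Real.continuousAt_log h.ne'))
    refine (hc2.congr ?_).continuousWithinAt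
    filter_upwards [Ioo_mem_nhds h ht.2] with s hs
    rw [logTransform, Real.exp_log hs.1, Real.exp_log (hpos s ⟨hs.1.le, hs.2⟩)]

theorem not_bddAbove_of_equivOn {u w : ℝ → ℝ} (h : EquivOn (Ico (0 : ℝ) 1) u w) (hw : IsWeight w) :
    ¬ BddAbove (u '' Ico 0 1) := by
  rintro ⟨M, hM⟩
  obtain ⟨a, b, ha, hb, h⟩ := h
  refine hw.unbounded ⟨b * M, ?_⟩
  rintro _ ⟨t, ht, rfl⟩
  exact (h t ht).2.trans (mul_le_mul_of_nonneg_left (hM ⟨t, ht, rfl⟩) hb.le)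

end LogConvex

/-! ### The associated weight and essential weights -/

section Associated

variable {w : ℝ → ℝ}

/-- The competitors in the definition of the associated weight. -/
def Dominated (w : ℝ → ℝ) (f : ℂ → ℂ) : Prop :=
  DifferentiableOn ℂ f disk ∧ ∀ ζ ∈ disk, ‖f ζ‖ ≤ w ‖ζ‖

theorem Dominated.norm_le {f : ℂ → ℂ} (hf : Dominated w f) {z : ℂ} (hz : z ∈ disk) :
    ‖f z‖ ≤ associatedWeight w z := by
  refine le_csSup ⟨w ‖z‖, ?_⟩ ⟨f, hf.1, hf.2, rfl⟩
  rintro _ ⟨g, -, hg, rfl⟩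
  exact hg z hz

theorem Dominated.comp_mul (hw : IsWeight w) {f : ℂ → ℂ} (hf : Dominated w f) {c : ℂ}
    (hc : ‖c‖ ≤ 1) : Dominated w fun z => f (c * z) := by
  have hle : ∀ z : ℂ, ‖c * z‖ ≤ ‖z‖ := fun z => by
    rw [norm_mul]
    exact mul_le_of_le_one_left (norm_nonneg z) hc
  have hmaps : ∀ z ∈ disk, c * z ∈ disk := fun z hz =>
    mem_ball_zero_iff.2 ((hle z).trans_lt (mem_ball_zero_iff.1 hz))
  refine ⟨hf.1.comp (by fun_prop) hmaps, fun z hz => ?_⟩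
  exact (hf.2 _ (hmaps z hz)).trans
    (hw.monotoneOn (norm_mem_Ico (hmaps z hz)) (norm_mem_Ico hz) (hle z))

/-- Write z = c t with |c| ≤ 1: the function f(c ·) is again a competitor, as `w` is radial and
nondecreasing. This replaces the maximum principle. -/
theorem Dominated.norm_le_of_norm_le (hw : IsWeight w) {f : ℂ → ℂ} (hf : Dominated w f) {z : ℂ}
    {t : ℝ} (ht : t < 1) (hzt : ‖z‖ ≤ t) : ‖f z‖ ≤ associatedWeight w t := by
  have ht0 : 0 ≤ t := (norm_nonneg z).trans hzt
  have htd := norm_lt_one_of_mem_Ico ⟨ht0, ht⟩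
  rcases ht0.eq_or_lt with h | h
  · subst h
    have : z = 0 := by simpa using hzt
    rw [this]
    exact_mod_cast hf.norm_le htd
  · have hc : ‖z / t‖ ≤ 1 := by
      rw [norm_div, Complex.norm_real, Real.norm_of_nonneg ht0]
      exact div_le_one_of_le₀ hzt ht0
    have := (hf.comp_mul hw hc).norm_le htd
    rwa [div_mul_cancel₀ _ (by exact_mod_cast h.ne')] at this

theorem dominated_const (hw : IsWeight w) : Dominated w fun _ => (w 0 : ℂ) := by
  refine ⟨by fun_prop, fun z hz => ?_⟩
  rw [Complex.norm_real, Real.norm_of_nonneg (hw.pos 0 zero_mem_Ico).le]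
  exact hw.monotoneOn zero_mem_Ico (norm_mem_Ico hz) (norm_nonneg z)

theorem associatedWeight_le_of_forall (hw : IsWeight w) {z : ℂ} {c : ℝ}
    (h : ∀ f, Dominated w f → ‖f z‖ ≤ c) : associatedWeight w z ≤ c := by
  refine csSup_le ⟨_, _, (dominated_const hw).1, (dominated_const hw).2, rfl⟩ ?_
  rintro _ ⟨f, hf, hf', rfl⟩
  exact h f ⟨hf, hf'⟩

theorem associatedWeight_le (hw : IsWeight w) {t : ℝ} (ht : t ∈ Ico (0 : ℝ) 1) :
    associatedWeight w t ≤ w t :=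
  associatedWeight_le_of_forall hw fun f hf => by
    simpa [abs_of_nonneg ht.1] using hf.2 t (norm_lt_one_of_mem_Ico ht)

theorem le_associatedWeight (hw : IsWeight w) {t : ℝ} (ht : t ∈ Ico (0 : ℝ) 1) :
    w 0 ≤ associatedWeight w t := by
  have := (dominated_const hw).norm_le (norm_lt_one_of_mem_Ico ht)
  rwa [Complex.norm_real, Real.norm_of_nonneg (hw.pos 0 zero_mem_Ico).le] at this

theorem isEssential_of_le (hw : IsWeight w) {C : ℝ} (hC : 0 < C)
    (h : ∀ t ∈ Ico (0 : ℝ) 1, w t ≤ C * associatedWeight w t) : IsEssential w :=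
  ⟨1, C, one_pos, hC, fun t ht => ⟨by simpa using associatedWeight_le hw ht, h t ht⟩⟩

/-- The three circles inequality for the associated weight. -/
theorem associatedWeight_exp_le (hw : IsWeight w) {x y θ : ℝ} (hxy : x < y) (hy : y < 0)
    (h0 : 0 ≤ θ) (h1 : θ ≤ 1) :
    associatedWeight w (Real.exp (x + θ * (y - x)) : ℝ) ≤
      associatedWeight w (Real.exp x : ℝ) ^ (1 - θ) * associatedWeight w (Real.exp y : ℝ) ^ θ := by
  refine associatedWeight_le_of_forall hw fun f hf => ?_
  -- The exponential carries the strip 0 ≤ Re ζ ≤ 1 to the annulus between the two radii, turning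
  -- three lines into three circles.
  set e : ℂ → ℂ := fun ζ => Complex.exp (x + ζ * (y - x))
  have hnorm : ∀ ζ, ‖e ζ‖ = Real.exp (x + ζ.re * (y - x)) := fun ζ => by
    simp [e, Complex.norm_exp]
  have hle : ∀ ζ ∈ Complex.HadamardThreeLines.verticalClosedStrip 0 1, ‖e ζ‖ ≤ Real.exp y :=
    fun ζ hζ => by
      rw [hnorm]
      have := mul_le_mul_of_nonneg_right hζ.2 (sub_nonneg.2 hxy.le)
      exact Real.exp_le_exp.2 (by linarith)
  have hmem : ∀ ζ ∈ Complex.HadamardThreeLines.verticalClosedStrip 0 1, e ζ ∈ disk :=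
    fun ζ hζ => mem_ball_zero_iff.2 ((hle ζ hζ).trans_lt (exp_mem_Ico hy).2)
  have hd : DiffContOnCl ℂ (f ∘ e) (Complex.HadamardThreeLines.verticalStrip 0 1) := by
    have hcl : closure (Complex.HadamardThreeLines.verticalStrip 0 1) ⊆
        Complex.HadamardThreeLines.verticalClosedStrip 0 1 :=
      closure_minimal (preimage_mono Ioo_subset_Icc_self) (isClosed_Icc.preimage Complex.continuous_re)
    refine DifferentiableOn.diffContOnCl (hf.1.comp (by fun_prop) fun ζ hζ => hmem ζ (hcl hζ))
  have key := Complex.HadamardThreeLines.norm_le_interp_of_mem_verticalClosedStrip₀₁' (f ∘ e)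
    (z := (θ : ℂ)) (a := associatedWeight w (Real.exp x : ℝ))
    (b := associatedWeight w (Real.exp y : ℝ)) ⟨by simpa using h0, by simpa using h1⟩ hd ?_ ?_ ?_
  · simpa [e] using key
  · refine ⟨w (Real.exp y), ?_⟩
    rintro _ ⟨ζ, hζ, rfl⟩
    exact (hf.2 _ (hmem ζ hζ)).trans
      (hw.monotoneOn (norm_mem_Ico (hmem ζ hζ)) (exp_mem_Ico hy) (hle ζ hζ))
  · intro ζ hζ
    refine hf.norm_le_of_norm_le hw (exp_mem_Ico (hxy.trans hy)).2 ?_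
    rw [hnorm, show ζ.re = 0 from hζ]
    simp
  · intro ζ hζ
    refine hf.norm_le_of_norm_le hw (exp_mem_Ico hy).2 ?_
    rw [hnorm, show ζ.re = 1 from hζ]
    simp

theorem associatedWeight_pos (hw : IsWeight w) {t : ℝ} (ht : t ∈ Ico (0 : ℝ) 1) :
    0 < associatedWeight w t := (hw.pos 0 zero_mem_Ico).trans_le (le_associatedWeight hw ht)

theorem isLogConvex_associatedWeight (hw : IsWeight w) :
    IsLogConvex fun t => associatedWeight w t := by
  refine LinearOrder.convexOn_of_lt (convex_Iio 0) fun x hx y hy hxy a θ ha hθ hab => ?_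
  have hpos : ∀ x < 0, 0 < associatedWeight w (Real.exp x : ℝ) :=
    fun x hx => associatedWeight_pos hw (exp_mem_Ico hx)
  obtain rfl : a = 1 - θ := by linarith
  have key := associatedWeight_exp_le hw hxy hy hθ.le (by linarith)
  have hz : x + θ * (y - x) < 0 := by
    have h1 : (1 - θ) * x < 0 := mul_neg_of_pos_of_neg ha hx
    have h2 : θ * y < 0 := mul_neg_of_pos_of_neg hθ hy
    linarith
  have := Real.log_le_log (hpos _ hz) key
  rw [Real.log_mul (Real.rpow_pos_of_pos (hpos x hx) _).ne' (Real.rpow_pos_of_pos (hpos y hy) _).ne',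
    Real.log_rpow (hpos x hx), Real.log_rpow (hpos y hy)] at this
  simp only [logTransform, smul_eq_mul]
  rwa [show (1 - θ) * x + θ * y = x + θ * (y - x) by ring]

/-- The associated weight itself is the required log-convex weight; the constant competitor `w 0`
gives it the value `w 0` at the origin, which yields continuity there. -/
theorem IsEssential.equivLogConvex (hw : IsWeight w) (h : IsEssential w) : EquivLogConvex w := by
  have hpos : ∀ t ∈ Ico (0 : ℝ) 1, 0 < associatedWeight w t := fun t => associatedWeight_pos hw
  have hmono : MonotoneOn (fun t : ℝ => associatedWeight w t) (Ico 0 1) := fun s hs t ht hst =>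
    associatedWeight_le_of_forall hw fun f hf =>
      hf.norm_le_of_norm_le hw ht.2 (by simpa [abs_of_nonneg hs.1] using hst)
  have hc := isLogConvex_associatedWeight hw
  refine ⟨fun t => associatedWeight w t, ⟨hpos, hmono, ?_, not_bddAbove_of_equivOn h hw⟩, hc, h⟩
  exact hc.continuousOn hpos hmono hw.continuousOn (fun t => associatedWeight_le hw)
    (le_antisymm (associatedWeight_le hw zero_mem_Ico) (le_associatedWeight hw zero_mem_Ico))

theorem ApproxByHolomorphicMap.isEssential (hw : IsWeight w) (h : ApproxByHolomorphicMap w) :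
    IsEssential w := by
  obtain ⟨n, f, hf, C₁, C₂, hC₁, hC₂, h⟩ := h
  refine isEssential_of_le hw (div_pos hC₂ hC₁) fun t ht => ?_
  have htd := norm_lt_one_of_mem_Ico ht
  have hft : ‖f t‖ ≠ 0 := fun h0 => by
    have h2 := (h t htd).2
    have h3 := hw.pos t ht
    simp only [h0, mul_zero, Complex.norm_real, Real.norm_of_nonneg ht.1] at h2
    linarith
  -- Projecting onto the direction of `f t` gives a scalar competitor that loses nothing at `t`; the
  -- direction depends on `t`, the constants do not.
  set e : EuclideanSpace ℂ (Fin n) := ((‖f t‖⁻¹ : ℝ) : ℂ) • f t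
  have he : ‖e‖ = 1 := by
    simp only [e, norm_smul, Complex.norm_real, norm_inv, norm_norm]
    exact inv_mul_cancel₀ hft
  have hdom : Dominated w fun z => (C₁ : ℂ) * inner ℂ e (f z) := by
    refine ⟨((innerSL ℂ e).differentiable.comp_differentiableOn hf).const_mul _, fun z hz => ?_⟩
    rw [norm_mul, Complex.norm_real, Real.norm_of_nonneg hC₁.le]
    refine le_trans (mul_le_mul_of_nonneg_left ?_ hC₁.le) (h z hz).1
    simpa [he] using norm_inner_le_norm (𝕜 := ℂ) e (f z)
  have h1 := hdom.norm_le htd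
  have h2 : ‖inner ℂ e (f t)‖ = ‖f t‖ := by
    simp only [e, inner_smul_left, inner_self_eq_norm_sq_to_K, norm_mul, Complex.conj_ofReal,
      Complex.norm_real, norm_inv, norm_norm, norm_pow, Complex.coe_algebraMap]
    field_simp
  rw [norm_mul, h2, Complex.norm_real, Real.norm_of_nonneg hC₁.le] at h1
  have h3 := (h t htd).2
  simp only [Complex.norm_real, Real.norm_of_nonneg ht.1] at h3
  refine h3.trans ?_
  rw [div_mul_eq_mul_div, le_div_iff₀ hC₁]
  nlinarith

theorem norm_le_maxModulus {f : ℂ → ℂ} (hf : DifferentiableOn ℂ f disk) {z : ℂ} (hz : z ∈ disk) :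
    ‖f z‖ ≤ maxModulus f ‖z‖ := by
  refine le_csSup ?_ ⟨z, by simp, rfl⟩
  refine (isCompact_sphere (0 : ℂ) ‖z‖).bddAbove_image (ContinuousOn.norm (hf.continuousOn.mono ?_))
  intro y hy
  rw [mem_ball_zero_iff, mem_sphere_zero_iff_norm.1 hy]
  exact (norm_mem_Ico hz).2

theorem maxModulus_le {f : ℂ → ℂ} {t c : ℝ} (ht : 0 ≤ t) (h : ∀ z : ℂ, ‖z‖ = t → ‖f z‖ ≤ c) :
    maxModulus f t ≤ c := by
  refine csSup_le ⟨_, t, by simp [abs_of_nonneg ht], rfl⟩ ?_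
  rintro _ ⟨z, hz, rfl⟩
  exact h z (mem_sphere_zero_iff_norm.1 hz)

theorem ApproxByMaxModulus.isEssential (hw : IsWeight w) (h : ApproxByMaxModulus w) :
    IsEssential w := by
  obtain ⟨f, hf, C₁, C₂, hC₁, hC₂, h⟩ := h
  refine isEssential_of_le hw (div_pos hC₂ hC₁) fun t ht => ?_
  have hdom : Dominated w fun z => (C₁ : ℂ) * f z := by
    refine ⟨hf.const_mul _, fun z hz => ?_⟩
    rw [norm_mul, Complex.norm_real, Real.norm_of_nonneg hC₁.le]
    exact le_trans (mul_le_mul_of_nonneg_left (norm_le_maxModulus hf hz) hC₁.le)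
      (h _ (norm_mem_Ico hz)).1
  have h1 : maxModulus f t ≤ associatedWeight w t / C₁ := maxModulus_le ht.1 fun z hz => by
    have := hdom.norm_le_of_norm_le hw ht.2 hz.le
    rw [norm_mul, Complex.norm_real, Real.norm_of_nonneg hC₁.le] at this
    rw [le_div_iff₀ hC₁]
    linarith
  refine (h t ht).2.trans ((mul_le_mul_of_nonneg_left h1 hC₂.le).trans_eq ?_)
  ring

end Associated

/-! ### Series with one dominant term -/

section Series

theorem holomorphic_series {c : ℕ → ℂ} {n : ℕ → ℕ}
    (hs : ∀ t ∈ Ico (0 : ℝ) 1, Summable fun j => ‖c j‖ * t ^ n j) :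
    DifferentiableOn ℂ (fun z => ∑' j, c j * z ^ n j) disk := by
  intro z hz
  obtain ⟨r, hzr, hr⟩ := exists_between (norm_mem_Ico hz).2
  have hr0 : 0 ≤ r := (norm_nonneg z).trans hzr.le
  have := Complex.differentiableOn_tsum_of_summable_norm (hs r ⟨hr0, hr⟩)
    (F := fun j z => c j * z ^ n j) (U := Metric.ball 0 r) (fun j => by fun_prop)
    Metric.isOpen_ball (fun j y hy => by
      rw [norm_mul, norm_pow]
      have := (mem_ball_zero_iff.1 hy).le
      gcongr)
  exact (this.differentiableAt (Metric.isOpen_ball.mem_nhds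
    (mem_ball_zero_iff.2 hzr))).differentiableWithinAt

theorem norm_series_le {c : ℕ → ℂ} {n : ℕ → ℕ} {z : ℂ}
    (hs : Summable fun j => ‖c j‖ * ‖z‖ ^ n j) :
    ‖∑' j, c j * z ^ n j‖ ≤ ∑' j, ‖c j‖ * ‖z‖ ^ n j := by
  have : ∀ j, ‖c j * z ^ n j‖ = ‖c j‖ * ‖z‖ ^ n j := fun j => by rw [norm_mul, norm_pow]
  simp only [← this] at hs ⊢
  exact norm_tsum_le_tsum_norm hs

/-- With nonnegative coefficients the maximum on a circle is attained at its positive point. -/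
theorem ApproxByPowerSeries.approxByMaxModulus {w : ℝ → ℝ} (h : ApproxByPowerSeries w) :
    ApproxByMaxModulus w := by
  obtain ⟨a, ha, hs, h⟩ := h
  have hn : ∀ k, ‖(a k : ℂ)‖ = a k := fun k => by
    rw [Complex.norm_real, Real.norm_of_nonneg (ha k)]
  have hd : DifferentiableOn ℂ (fun z : ℂ => ∑' k, (a k : ℂ) * z ^ k) disk :=
    holomorphic_series (n := id) (by simpa only [hn, id] using hs)
  refine ⟨_, hd, h.of_eq fun t ht => le_antisymm ?_ ?_⟩
  · refine maxModulus_le ht.1 fun z hz => ?_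
    have := norm_series_le (c := fun k => (a k : ℂ)) (n := id) (z := z)
      (by simpa only [hn, hz, id] using hs t ht)
    simpa only [hn, hz, id] using this
  · have := norm_le_maxModulus hd (norm_lt_one_of_mem_Ico ht)
    have e : ∑' k, (a k : ℂ) * (t : ℂ) ^ k = ((∑' k, a k * t ^ k : ℝ) : ℂ) := by
      push_cast
      rfl
    rw [e, Complex.norm_real, Complex.norm_real, Real.norm_of_nonneg ht.1] at this
    exact (le_abs_self _).trans this

theorem tail_dist_eq (K i : ℕ) : (i + (K + 1) - K) + (K - (i + (K + 1))) = i + 1 := by omega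

theorem summable_pow_dist (K : ℕ) :
    Summable fun j : ℕ => (1 / 4 : ℝ) ^ ((j - K) + (K - j)) := by
  rw [← summable_nat_add_iff (K + 1)]
  simp only [tail_dist_eq, pow_succ]
  exact (summable_geometric_of_lt_one (by norm_num) (by norm_num)).mul_right _

theorem tsum_pow_dist_le (K : ℕ) :
    ∑' j : ℕ, (1 / 4 : ℝ) ^ ((j - K) + (K - j)) ≤ 5 / 3 := by
  have hg : Summable fun j : ℕ => (1 / 4 : ℝ) ^ j :=
    summable_geometric_of_lt_one (by norm_num) (by norm_num)
  have ht : ∑' j : ℕ, (1 / 4 : ℝ) ^ j = 4 / 3 := by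
    rw [tsum_geometric_of_lt_one (by norm_num) (by norm_num)]
    norm_num
  rw [← (summable_pow_dist K).sum_add_tsum_nat_add (K + 1)]
  have h1 : ∑ j ∈ Finset.range (K + 1), (1 / 4 : ℝ) ^ ((j - K) + (K - j)) ≤ 4 / 3 := by
    rw [← ht]
    refine le_trans (le_of_eq ?_) (hg.sum_le_tsum (Finset.range (K + 1)) fun i _ => by positivity)
    rw [← Finset.sum_flip]
    refine Finset.sum_congr rfl fun j hj => ?_
    rw [Nat.sub_eq_zero_of_le (Nat.sub_le K j), zero_add,
      Nat.sub_sub_self (Nat.lt_succ_iff.1 (Finset.mem_range.1 hj))]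
  have h2 : ∑' j : ℕ, (1 / 4 : ℝ) ^ ((j + (K + 1) - K) + (K - (j + (K + 1)))) = 1 / 3 := by
    simp only [tail_dist_eq, pow_succ]
    rw [tsum_mul_right, ht]
    norm_num
  linarith

/-- A series whose terms decay geometrically away from the `K`-th one is comparable to that term. -/
theorem le_norm_tsum_of_decay {x : ℕ → ℂ} {K : ℕ}
    (h : ∀ j, ‖x j‖ ≤ (1 / 4) ^ ((j - K) + (K - j)) * ‖x K‖) : ‖x K‖ ≤ 3 * ‖∑' j, x j‖ := by
  have hs : Summable fun j => ‖x j‖ :=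
    Summable.of_nonneg_of_le (fun j => norm_nonneg _) h ((summable_pow_dist K).mul_right _)
  have hle : ∑' j, ‖x j‖ ≤ 5 / 3 * ‖x K‖ := by
    refine (hs.tsum_le_tsum h ((summable_pow_dist K).mul_right _)).trans ?_
    rw [tsum_mul_right]
    exact mul_le_mul_of_nonneg_right (tsum_pow_dist_le K) (norm_nonneg _)
  -- Without the `K`-th term, the norms sum to at most 5/3 - 1 = 2/3 of `‖x K‖`, so a third of it
  -- survives any cancellation.
  have e1 := hs.of_norm.tsum_eq_add_tsum_ite K
  have e2 := hs.tsum_eq_add_tsum_ite K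
  have hn : ∀ j, ‖if j = K then 0 else x j‖ = if j = K then 0 else ‖x j‖ := fun j => by
    split_ifs <;> simp
  have hs' : Summable fun j => ‖if j = K then 0 else x j‖ :=
    Summable.of_nonneg_of_le (fun j => norm_nonneg _) (fun j => by
      rw [hn]; split_ifs <;> simp) hs
  have h3 := norm_tsum_le_tsum_norm hs'
  simp only [hn] at h3
  have h4 : ‖x K‖ ≤ ‖∑' j, x j‖ + ‖∑' j, if j = K then 0 else x j‖ := by
    rw [e1]
    refine le_trans (le_of_eq ?_) (norm_sub_le _ _)
    rw [add_sub_cancel_right]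
  linarith

end Series

/-! ### Power series and maps into ℂ² from lacunary terms -/

section Approximation

variable {v : ℝ → ℝ}

/-- The terms `a j * t ^ n j` decay geometrically away from one of them, which is comparable
to `v t`. -/
def IsLacunaryApprox (v : ℝ → ℝ) (n : ℕ → ℕ) (a : ℕ → ℝ) (C : ℝ) : Prop :=
  ∀ t ∈ Ico (0 : ℝ) 1, ∃ K, a K * t ^ n K ≤ v t ∧ v t ≤ C * (a K * t ^ n K) ∧
    ∀ j, a j * t ^ n j ≤ 16 * (1 / 16) ^ ((j - K) + (K - j)) * (a K * t ^ n K)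

variable {n : ℕ → ℕ} {a : ℕ → ℝ} {C : ℝ}

theorem IsLacunaryApprox.summable (h : IsLacunaryApprox v n a C) (ha : ∀ j, 0 < a j) {t : ℝ}
    (ht : t ∈ Ico (0 : ℝ) 1) :
    (Summable fun j => a j * t ^ n j) ∧ ∑' j, a j * t ^ n j ≤ 27 * v t := by
  have h0 : ∀ j, 0 ≤ a j * t ^ n j := fun j => mul_nonneg (ha j).le (pow_nonneg ht.1 _)
  obtain ⟨K, hK, -, hdec⟩ := h t ht
  have hle : ∀ j, a j * t ^ n j ≤ (1 / 4) ^ ((j - K) + (K - j)) * (16 * (a K * t ^ n K)) :=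
    fun j => by
      have h1 : (1 / 16 : ℝ) ^ ((j - K) + (K - j)) ≤ (1 / 4) ^ ((j - K) + (K - j)) :=
        pow_le_pow_left₀ (by norm_num) (by norm_num) _
      have h2 := mul_le_mul_of_nonneg_right h1 (mul_nonneg (by norm_num : (0 : ℝ) ≤ 16) (h0 K))
      linarith [hdec j]
  have hs := Summable.of_nonneg_of_le h0 hle ((summable_pow_dist K).mul_right _)
  refine ⟨hs, (hs.tsum_le_tsum hle ((summable_pow_dist K).mul_right _)).trans ?_⟩
  -- The constant 27 bounds 16 · 5/3 = 80/3.
  rw [tsum_mul_right]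
  have := mul_le_mul_of_nonneg_right (tsum_pow_dist_le K)
    (mul_nonneg (by norm_num : (0 : ℝ) ≤ 16) (h0 K))
  linarith [h0 K]

theorem IsLacunaryApprox.approxByPowerSeries (h : IsLacunaryApprox v n a C) (ha : ∀ j, 0 < a j)
    (hC : 0 < C) (hn : StrictMono n) : ApproxByPowerSeries v := by
  have hs : ∀ t ∈ Ico (0 : ℝ) 1,
      HasSum (fun k => Function.extend n a 0 k * t ^ k) (∑' j, a j * t ^ n j) := fun t ht => by
    rw [← hn.injective.hasSum_iff]
    · simpa [Function.comp_def, hn.injective.extend_apply] using (h.summable ha ht).1.hasSum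
    · intro k hk
      rw [Function.extend_apply' _ _ _ hk]
      simp
  refine ⟨Function.extend n a 0, fun k => ?_, fun t ht => (hs t ht).summable, 1 / 27, C,
    by norm_num, hC, fun t ht => ?_⟩
  · by_cases hk : ∃ j, n j = k
    · obtain ⟨j, rfl⟩ := hk
      rw [hn.injective.extend_apply]
      exact (ha j).le
    · rw [Function.extend_apply' _ _ _ hk]
      rfl
  · obtain ⟨hsum, hle⟩ := h.summable ha ht
    obtain ⟨K, -, hK, -⟩ := h t ht
    simp only [(hs t ht).tsum_eq]
    refine ⟨by linarith, hK.trans (mul_le_mul_of_nonneg_left ?_ hC.le)⟩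
    exact hsum.le_tsum K fun j _ => mul_nonneg (ha j).le (pow_nonneg ht.1 _)

/-- Distinct indices of equal parity are at distance d ≥ 2, and then 16 ≤ 4 ^ d. -/
theorem pow_dist_le_of_parity {j K : ℕ} (hp : j % 2 = K % 2) (hjK : j ≠ K) :
    16 * (1 / 16 : ℝ) ^ ((j - K) + (K - j)) ≤ (1 / 4) ^ ((j - K) + (K - j)) := by
  obtain ⟨d, hd⟩ : ∃ d, (j - K) + (K - j) = d + 2 := ⟨(j - K) + (K - j) - 2, by omega⟩
  have h1 : (1 / 16 : ℝ) ^ d ≤ (1 / 4) ^ d := pow_le_pow_left₀ (by norm_num) (by norm_num) _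
  rw [hd, pow_add, pow_add]
  linarith

theorem IsLacunaryApprox.approxByHolomorphicMap (h : IsLacunaryApprox v n a C)
    (ha : ∀ j, 0 < a j) (hC : 0 < C) : ApproxByHolomorphicMap v := by
  set c : Fin 2 → ℕ → ℂ := fun p j => if j % 2 = p then (a j : ℂ) else 0
  have hc : ∀ p j, ‖c p j‖ ≤ a j := fun p j => by
    simp only [c]
    split_ifs
    · rw [Complex.norm_real, Real.norm_of_nonneg (ha j).le]
    · simpa using (ha j).le
  have hterm : ∀ p, ∀ t ∈ Ico (0 : ℝ) 1, ∀ j, ‖c p j‖ * t ^ n j ≤ a j * t ^ n j :=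
    fun p t ht j => mul_le_mul_of_nonneg_right (hc p j) (pow_nonneg ht.1 _)
  have hs : ∀ p, ∀ t ∈ Ico (0 : ℝ) 1, Summable fun j => ‖c p j‖ * t ^ n j := fun p t ht =>
    Summable.of_nonneg_of_le (fun j => mul_nonneg (norm_nonneg _) (pow_nonneg ht.1 _))
      (hterm p t ht) (h.summable ha ht).1
  set F : Fin 2 → ℂ → ℂ := fun p z => ∑' j, c p j * z ^ n j
  have hF : ∀ p, ∀ z ∈ disk, ‖F p z‖ ≤ 27 * v ‖z‖ := fun p z hz => by
    have ht := norm_mem_Ico hz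
    refine (norm_series_le (hs p _ ht)).trans (le_trans ?_ (h.summable ha ht).2)
    exact (hs p _ ht).tsum_le_tsum (hterm p _ ht) (h.summable ha ht).1
  refine ⟨2, fun z => WithLp.toLp 2 fun p => F p z, ?_, 1 / 54, 3 * C, by norm_num,
    by positivity, fun z hz => ⟨?_, ?_⟩⟩
  · exact differentiableOn_euclidean.2 fun p => holomorphic_series (hs p)
  · have h0 := hF 0 z hz
    have h1 := hF 1 z hz
    have : ‖(WithLp.toLp 2 fun p => F p z : EuclideanSpace ℂ (Fin 2))‖ ≤ ‖F 0 z‖ + ‖F 1 z‖ := by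
      rw [EuclideanSpace.norm_eq, Fin.sum_univ_two]
      refine Real.sqrt_le_iff.2 ⟨by positivity, ?_⟩
      simp only
      nlinarith [mul_nonneg (norm_nonneg (F 0 z)) (norm_nonneg (F 1 z))]
    simp only
    linarith
  · obtain ⟨K, -, hK, hdec⟩ := h ‖z‖ (norm_mem_Ico hz)
    have hp : K % 2 < 2 := Nat.mod_lt _ two_pos
    have hcK : ∀ j, j % 2 = K % 2 → ‖c ⟨K % 2, hp⟩ j * z ^ n j‖ = a j * ‖z‖ ^ n j := fun j hj => by
      simp only [c, hj, if_true]
      rw [norm_mul, norm_pow, Complex.norm_real, Real.norm_of_nonneg (ha j).le]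
    -- Only the component with the parity of `K` is bounded below; there the two neighbours of `K`
    -- are absent.
    have key := le_norm_tsum_of_decay (x := fun j => c ⟨K % 2, hp⟩ j * z ^ n j) (K := K) fun j => by
      by_cases hj : j % 2 = K % 2
      · rcases eq_or_ne j K with rfl | hjK
        · simp
        · rw [hcK j hj, hcK K rfl]
          exact (hdec j).trans (mul_le_mul_of_nonneg_right (pow_dist_le_of_parity hj hjK)
            (mul_nonneg (ha K).le (by positivity)))
      · have : c ⟨K % 2, hp⟩ j = 0 := if_neg hj
        rw [this, zero_mul, norm_zero]
        positivity
    simp only [hcK K rfl] at key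
    have h2 := PiLp.norm_apply_le (WithLp.toLp 2 fun p => F p z : EuclideanSpace ℂ (Fin 2))
      ⟨K % 2, hp⟩
    have h3 : a K * ‖z‖ ^ n K ≤
        3 * ‖(WithLp.toLp 2 fun p => F p z : EuclideanSpace ℂ (Fin 2))‖ :=
      key.trans (mul_le_mul_of_nonneg_left h2 (by norm_num))
    refine hK.trans ((mul_le_mul_of_nonneg_left h3 hC.le).trans_eq ?_)
    ring

end Approximation

/-! ### Log-tropical weights -/

section Tropical

theorem IsTropicalPowerSeries.convexOn {Ψ : ℝ → ℝ} (h : IsTropicalPowerSeries Ψ) :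
    ConvexOn ℝ (Iio 0) Ψ := by
  obtain ⟨E, b, h⟩ := h
  refine ⟨convex_Iio 0, fun x hx y hy s r hs hr hsr => ?_⟩
  refine (h _ ((convex_Iio (0 : ℝ)) hx hy hs hr hsr)).2 ?_
  rintro _ ⟨j, hj, rfl⟩
  have h1 := mul_le_mul_of_nonneg_left ((h x hx).1 ⟨j, hj, rfl⟩) hs
  have h2 := mul_le_mul_of_nonneg_left ((h y hy).1 ⟨j, hj, rfl⟩) hr
  have h3 : b j = s * b j + r * b j := by rw [← add_mul, hsr, one_mul]
  simp only [smul_eq_mul] at *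
  rw [h3]
  linarith

theorem EquivLogTropical.equivLogConvex {w : ℝ → ℝ} (h : EquivLogTropical w) :
    EquivLogConvex w := by
  obtain ⟨v, hv, ht, h⟩ := h
  exact ⟨v, hv, ht.convexOn, h⟩

variable {v : ℝ → ℝ}

/-- The largest log-tropical minorant of a log-convex weight. -/
noncomputable def tropicalMinorant (v : ℝ → ℝ) (t : ℝ) : ℝ :=
  if t = 0 then v 0 else Real.exp (⨆ m, line (intercept (logTransform v)) m (Real.log t))

theorem IsWeight.isLUB_line_intercept (hv : IsWeight v) {x : ℝ} (hx : x < 0) :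
    IsLUB (range fun m => line (intercept (logTransform v)) m x)
      (⨆ m, line (intercept (logTransform v)) m x) :=
  isLUB_ciSup ⟨logTransform v x, by
    rintro _ ⟨m, rfl⟩
    exact line_intercept_le hv.log_le_logTransform m hx⟩

theorem IsWeight.log_le_intercept_zero (hv : IsWeight v) :
    Real.log (v 0) ≤ intercept (logTransform v) 0 :=
  le_intercept fun x hx => by simpa using hv.log_le_logTransform x hx

theorem equivLogTropical_of_isLogConvex (hv : IsWeight v) (hc : IsLogConvex v) :
    EquivLogTropical v := by
  have hL := hv.log_le_logTransform
  have hv0 := hv.pos 0 zero_mem_Ico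
  set b := intercept (logTransform v) with hb
  set Ψ : ℝ → ℝ := fun x => ⨆ m, line b m x with hΨ
  set u := tropicalMinorant v
  -- The origin is treated apart, since `Real.log 0 = 0` would give a meaningless value and the log
  -- transform does not see t = 0.
  have hu0 : u 0 = v 0 := if_pos rfl
  have hu : ∀ t : ℝ, 0 < t → u t = Real.exp (Ψ (Real.log t)) := fun t ht => if_neg ht.ne'
  have hlog : ∀ x, logTransform u x = Ψ x := fun x => by
    rw [logTransform, hu _ (Real.exp_pos x), Real.log_exp, Real.log_exp]
  have htrop : IsTropicalPowerSeries (logTransform u) := by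
    refine ⟨univ, b, fun x hx => ?_⟩
    rw [hlog, image_univ]
    exact hv.isLUB_line_intercept hx
  have hpos : ∀ t ∈ Ico (0 : ℝ) 1, 0 < u t := fun t ht => by
    rcases ht.1.eq_or_lt with h | h
    · rw [← h, hu0]; exact hv0
    · rw [hu t h]; exact Real.exp_pos _
  have hline : ∀ x < 0, ∀ m, line b m x ≤ Ψ x := fun x hx m =>
    (hv.isLUB_line_intercept hx).1 ⟨m, rfl⟩
  have hmono : MonotoneOn u (Ico 0 1) := by
    intro s hs t ht hst
    rcases hs.1.eq_or_lt with h | h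
    · rw [← h, hu0]
      rcases ht.1.eq_or_lt with h' | h'
      · rw [← h', hu0]
      · have h1 := hline (Real.log t) (Real.log_neg h' ht.2) 0
        simp only [line, Nat.cast_zero, zero_mul, add_zero] at h1
        rw [hu t h', ← Real.log_le_iff_le_exp hv0]
        exact hv.log_le_intercept_zero.trans h1
    · have ht0 := h.trans_le hst
      rw [hu s h, hu t ht0]
      refine Real.exp_le_exp.2 (ciSup_le fun m => ?_)
      refine le_trans ?_ (hline (Real.log t) (Real.log_neg ht0 ht.2) m)
      have := mul_le_mul_of_nonneg_left (Real.log_le_log h hst) (Nat.cast_nonneg m (α := ℝ))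
      unfold line
      linarith
  have hle : ∀ t ∈ Ico (0 : ℝ) 1, u t ≤ v t := fun t ht => by
    rcases ht.1.eq_or_lt with h | h
    · rw [← h, hu0]
    · have hx := Real.log_neg h ht.2
      have := hv.exp_logTransform hx
      rw [Real.exp_log h] at this
      rw [hu t h, ← this]
      exact Real.exp_le_exp.2 (ciSup_le fun m => line_intercept_le hL m hx)
  set D := 1 + logTransform v (-1) - Real.log (v 0)
  have hD : 0 ≤ D := by linarith [hL (-1) (by norm_num)]
  have hequiv : EquivOn (Ico (0 : ℝ) 1) u v := by
    refine ⟨1, Real.exp D, one_pos, Real.exp_pos _, fun t ht => ⟨by simpa using hle t ht, ?_⟩⟩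
    rcases ht.1.eq_or_lt with h | h
    · rw [← h, hu0]
      exact le_mul_of_one_le_left hv0.le (Real.one_le_exp hD)
    · have hx := Real.log_neg h ht.2
      have := hv.exp_logTransform hx
      rw [Real.exp_log h] at this
      obtain ⟨m, hm⟩ := exists_le_line_intercept_add hc hv.monotoneOn_logTransform hL hx
      rw [hu t h, ← this, ← Real.exp_add]
      refine Real.exp_le_exp.2 ?_
      linarith [hline _ hx m]
  exact ⟨u, ⟨hpos, hmono, IsLogConvex.continuousOn htrop.convexOn hpos hmono hv.continuousOn hle hu0,
    not_bddAbove_of_equivOn hequiv hv⟩, htrop, hequiv⟩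

end Tropical

/-! ### Transfer along equivalence, and the cycle of implications -/

section Transfer

variable {w : ℝ → ℝ}

theorem EquivLogConvex.equivLogTropical (h : EquivLogConvex w) : EquivLogTropical w := by
  obtain ⟨v, hv, hc, h⟩ := h
  obtain ⟨u, hu, ht, h'⟩ := equivLogTropical_of_isLogConvex hv hc
  exact ⟨u, hu, ht, h'.trans h⟩

theorem EquivLogConvex.approxByPowerSeries (h : EquivLogConvex w) : ApproxByPowerSeries w := by
  obtain ⟨v, hv, hc, h⟩ := h
  obtain ⟨n, hn, a, ha, C, hC, hl⟩ := exists_lacunary_terms hv hc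
  obtain ⟨c, hc0, hs, h'⟩ := IsLacunaryApprox.approxByPowerSeries hl ha hC hn
  exact ⟨c, hc0, hs, h'.trans h⟩

theorem EquivLogConvex.approxByHolomorphicMap (h : EquivLogConvex w) :
    ApproxByHolomorphicMap w := by
  obtain ⟨v, hv, hc, h⟩ := h
  obtain ⟨n, -, a, ha, C, hC, hl⟩ := exists_lacunary_terms hv hc
  obtain ⟨p, f, hf, h'⟩ := IsLacunaryApprox.approxByHolomorphicMap hl ha hC
  exact ⟨p, f, hf, h'.trans (h.comp fun z hz => norm_mem_Ico hz)⟩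

end Transfer

end DiskWeight

theorem theorem2p3 (w : ℝ → ℝ) (hw : DiskWeight.IsWeight w) :
    List.TFAE [
      DiskWeight.ApproxByHolomorphicMap w,
      DiskWeight.IsEssential w,
      DiskWeight.ApproxByMaxModulus w,
      DiskWeight.ApproxByPowerSeries w,
      DiskWeight.EquivLogTropical w,
      DiskWeight.EquivLogConvex w] := by
  tfae_have 1 → 2 := fun h => h.isEssential hw
  tfae_have 2 → 6 := fun h => h.equivLogConvex hw
  tfae_have 6 → 1 := fun h => h.approxByHolomorphicMap
  tfae_have 6 → 4 := fun h => h.approxByPowerSeries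
  tfae_have 4 → 3 := fun h => h.approxByMaxModulus
  tfae_have 3 → 2 := fun h => h.isEssential hw
  tfae_have 6 → 5 := fun h => h.equivLogTropical
  tfae_have 5 → 6 := fun h => h.equivLogConvex
  tfae_finish
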